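/- Let $M$ be a smooth $n$-dimensional (Hausdorff) manifold, $J$ an almost complex structure on $M$ (a smooth field of endomorphisms of $TM$ with $J^2=-\mathrm{Id}$), and $\nabla$ a smooth connection on $TM$ with torsion $T$. Put $\widetilde\nabla:=\nabla-\tfrac12T$. Let $\pi:T^*M\to M$ be the projection, $\theta$ the Liouville form, and $\omega_{st}=d\theta$. * For a $(1,1)$-tensor $R$ on $M$, let $\theta(R)$ be the one-form on $T^*M$ given by $\theta(R)_\xi(Y)=\xi(R(d\pi Y))$. The complete lift $J^c$ is the $(1,1)$-tensor on $T^*M$ determined by $d(\theta(J))=\omega_{st}(J^c\cdot,\cdot)$. * For a $(1,2)$-tensor $R$ on $M$, let $\gamma(R)$ be the $(1,1)$-tensor on $T^*M$ such that $\gamma(R)_\xi(Y)$ is the vertical vector at $\xi$ corresponding to the covector $\xi(R(d\pi Y,\cdot))$. Let $(\widetilde\nabla J)(X,Y)=\widetilde\nabla_X(JY)-J\widetilde\nabla_XY$ and $[\widetilde\nabla J](X,Y)=-(\widetilde\nabla J)(X,Y)+(\widetilde\nabla J)(Y,X)$. The Ishihara–Yano horizontal lift of $J$ is $J^{H,\nabla}:=J^c+\gamma([\widetilde\nabla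 J])$. * For a connection $\nabla'$ on $TM$, with the induced connection $(\nabla'_Xs)(Y)=X.s(Y)-s(\nabla'_XY)$ on $T^*M$, let $H^{\nabla'}_\xi=\{d_xs(X): X\in T_xM,\ s\in\Gamma(T^*M),\ s(x)=\xi,\ \nabla'_Xs=0\}$, where $x=\pi(\xi)$. The generalized horizontal lift $J^{G,\nabla'}$ is the field of endomorphisms of $T(T^*M)$ equal to $J\oplus{}^tJ$ in the decomposition $T_\xi T^*M=H^{\nabla'}_\xi\oplus T_x^*M$: it maps $h+\alpha$ to $h'+\alpha\circ J$, where $h'\in H^{\nabla'}_\xi$ is the horizontal vector with $d\pi(h')=J\,d\pi(h)$. Then $J^c$ and $J^{G,\widetilde\nabla}$ are well defined (each exists and is unique), and $$J^{H,\nabla}=J^{G,\widetilde\nabla}.$$ -/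

import Mathlib

open Bundle FiberBundle
open scoped Manifold ContDiff

noncomputable section

namespace CotangentLift

/-! ### The exterior derivative of a one-form on a manifold without boundary -/

section ExteriorDerivative

variable {E : Type*} [NormedAddCommGroup E] [NormedSpace ℝ E]
  {H : Type*} [TopologicalSpace H] (I : ModelWithCorners ℝ E H)
  {N : Type*} [TopologicalSpace N] [ChartedSpace H N]

/-- The expression of a one-form `α` in the preferred chart `φ` at `x₀`: the pullback of `α` by
`φ⁻¹`, a one-form on the model space (meaningful on the target of `φ`). -/
def oneFormInChart (α : ∀ x : N, TangentSpace I x →L[ℝ] ℝ) (x₀ : N) :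
    E → E [⋀^Fin 1]→L[ℝ] ℝ := fun y =>
  ContinuousAlternatingMap.ofSubsingleton ℝ E ℝ (0 : Fin 1)
    ((α ((extChartAt I x₀).symm y)).comp (mfderiv 𝓘(ℝ, E) I (extChartAt I x₀).symm y))

/-- The exterior derivative `dα` of a one-form `α` on a manifold without boundary, evaluated at a
pair of tangent vectors at `x`: the exterior derivative in the model space of the expression of `α`
in the chart `φ` at `x`, pulled back by `φ`. -/
def extDerivOneForm (α : ∀ x : N, TangentSpace I x →L[ℝ] ℝ) (x : N)
    (v w : TangentSpace I x) : ℝ :=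
  extDeriv (oneFormInChart I α x) (extChartAt I x x)
    ![mfderiv I 𝓘(ℝ, E) (extChartAt I x) x v, mfderiv I 𝓘(ℝ, E) (extChartAt I x) x w]

end ExteriorDerivative

/-! ### The cotangent bundle -/

section Cotangent

variable (n : ℕ) (M : Type*) [TopologicalSpace M] [ChartedSpace (EuclideanSpace ℝ (Fin n)) M]

/-- The model fibre of the cotangent bundle: the dual of `ℝⁿ`. -/
abbrev Dual : Type := EuclideanSpace ℝ (Fin n) →L[ℝ] ℝ

variable {M}

/-- The cotangent space `T*ₓM`. -/
abbrev CotangentSpace (x : M) : Type := TangentSpace (𝓡 n) x →L[ℝ] Bundle.Trivial M ℝ x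

variable (M)

/-- The cotangent bundle `T*M`, as a manifold modelled on `ℝⁿ × (ℝⁿ)*`. -/
abbrev CotangentBundle : Type _ := TotalSpace (Dual n) (CotangentSpace n : M → Type)

/-- The model with corners of `T*M`. -/
abbrev cotModel : ModelWithCorners ℝ (EuclideanSpace ℝ (Fin n) × Dual n)
    (ModelProd (EuclideanSpace ℝ (Fin n)) (Dual n)) :=
  (𝓡 n).prod 𝓘(ℝ, Dual n)

variable [IsManifold (𝓡 n) ∞ M]

variable {n M}

/-- The differential at `ξ` of the projection `π : T*M → M`. -/
def dπ (ξ : CotangentBundle n M) :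
    TangentSpace (cotModel n) ξ →L[ℝ] TangentSpace (𝓡 n) ξ.proj :=
  mfderiv (cotModel n) (𝓡 n) (TotalSpace.proj : CotangentBundle n M → M) ξ

/-- The canonical embedding of `T*ₓM`, where `x = π(ξ)`, into `T_ξ T*M` as the vertical space: the
differential at `ξ` of the inclusion of the fibre `T*ₓM` into `T*M`. -/
def vert (ξ : CotangentBundle n M) :
    CotangentSpace n ξ.proj →L[ℝ] TangentSpace (cotModel n) ξ :=
  mfderiv 𝓘(ℝ, Dual n) (cotModel n)
    (fun p : Dual n => (TotalSpace.mk ξ.proj p : CotangentBundle n M)) ξ.snd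

/-- For a field of endomorphisms `R` of `TM`, the one-form `θ(R)` on `T*M`,
`θ(R)_ξ(Y) = ξ(R(dπ Y))`; in coordinates `p_k R^k_l dx^l`. -/
def thetaForm (R : ∀ x : M, TangentSpace (𝓡 n) x →L[ℝ] TangentSpace (𝓡 n) x)
    (ξ : CotangentBundle n M) : TangentSpace (cotModel n) ξ →L[ℝ] ℝ :=
  ξ.snd.comp ((R ξ.proj).comp (dπ ξ))

/-- The Liouville form `θ` of `T*M`, `θ_ξ(Y) = ξ(dπ Y)`. -/
def liouville (ξ : CotangentBundle n M) : TangentSpace (cotModel n) ξ →L[ℝ] ℝ :=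
  ξ.snd.comp (dπ ξ)

/-- The canonical symplectic form `ω = dθ` of `T*M`. -/
def omegaSt (ξ : CotangentBundle n M) (Y Z : TangentSpace (cotModel n) ξ) : ℝ :=
  extDerivOneForm (cotModel n) (liouville (n := n) (M := M)) ξ Y Z

/-- The contraction `γ(R)`, a field of endomorphisms of `T(T*M)`, of a tensor `R` of type `(1,2)`
on `M`: `γ(R)(Y)` is the vertical vector given by the covector `ξ(R(dπ Y, ·))`; in coordinates
`p_k R^k_{ij} dx^i ⊗ ∂p_j`. -/
def gammaContraction
    (R : ∀ x : M, TangentSpace (𝓡 n) x →L[ℝ] TangentSpace (𝓡 n) x →L[ℝ] TangentSpace (𝓡 n) x)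
    (ξ : CotangentBundle n M) :
    TangentSpace (cotModel n) ξ →L[ℝ] TangentSpace (cotModel n) ξ :=
  (vert ξ).comp
    ((ContinuousLinearMap.compL ℝ (EuclideanSpace ℝ (Fin n)) (EuclideanSpace ℝ (Fin n)) ℝ
      ξ.snd).comp ((R ξ.proj).comp (dπ ξ)))

end Cotangent

/-! ### Almost complex structures and connections -/

section Swap

variable {n : ℕ} {M : Type*} [TopologicalSpace M] [ChartedSpace (EuclideanSpace ℝ (Fin n)) M]

/-- Interchange of the two arguments of a bilinear map on a tangent space. -/
def swapArgs {x : M}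
    (B : TangentSpace (𝓡 n) x →L[ℝ] TangentSpace (𝓡 n) x →L[ℝ] TangentSpace (𝓡 n) x) :
    TangentSpace (𝓡 n) x →L[ℝ] TangentSpace (𝓡 n) x →L[ℝ] TangentSpace (𝓡 n) x :=
  let B' : EuclideanSpace ℝ (Fin n) →L[ℝ] EuclideanSpace ℝ (Fin n) →L[ℝ]
    EuclideanSpace ℝ (Fin n) := B
  B'.flip

@[simp] theorem swapArgs_apply {x : M}
    (B : TangentSpace (𝓡 n) x →L[ℝ] TangentSpace (𝓡 n) x →L[ℝ] TangentSpace (𝓡 n) x)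
    (u v : TangentSpace (𝓡 n) x) : swapArgs B u v = B v u := rfl

end Swap

section Base

variable (n : ℕ) (M : Type*) [TopologicalSpace M] [ChartedSpace (EuclideanSpace ℝ (Fin n)) M]
  [IsManifold (𝓡 n) ∞ M]

/-- An almost complex structure on `M`: a smooth field `J` of endomorphisms of the tangent spaces
with `J² = -Id`. -/
structure AlmostComplexStructure where
  toFun : ∀ x : M, TangentSpace (𝓡 n) x →L[ℝ] TangentSpace (𝓡 n) x
  smooth : ContMDiff (𝓡 n)
    ((𝓡 n).prod 𝓘(ℝ, EuclideanSpace ℝ (Fin n) →L[ℝ] EuclideanSpace ℝ (Fin n))) ∞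
    (fun x => TotalSpace.mk' (EuclideanSpace ℝ (Fin n) →L[ℝ] EuclideanSpace ℝ (Fin n))
      (E := fun y : M => TangentSpace (𝓡 n) y →L[ℝ] TangentSpace (𝓡 n) y) x (toFun x))
  sq_eq_neg : ∀ (x : M) (v : TangentSpace (𝓡 n) x), toFun x (toFun x v) = -v

instance : CoeFun (AlmostComplexStructure n M)
    (fun _ => ∀ x : M, TangentSpace (𝓡 n) x →L[ℝ] TangentSpace (𝓡 n) x) :=
  ⟨AlmostComplexStructure.toFun⟩

/-- Connections (covariant derivatives on the tangent bundle). The value of `∇_X Y` at `x` is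
written `∇ Y x (X x)`. -/
abbrev Connection :=
  CovariantDerivative (𝓡 n) (EuclideanSpace ℝ (Fin n)) (TangentSpace (𝓡 n) : M → Type)

variable {n M}

/-- The connection `∇̃ = ∇ - ½ T`, where `T` is the torsion of `∇`. -/
def symmetrized (nabla : Connection n M) : Connection n M :=
  nabla.addOneForm fun x => -(1 / 2 : ℝ) • swapArgs (nabla.torsion x)

theorem symmetrized_apply (nabla : Connection n M) (Y : ∀ x : M, TangentSpace (𝓡 n) x) (x : M)
    (u : TangentSpace (𝓡 n) x) :
    symmetrized nabla Y x u = nabla Y x u - (1 / 2 : ℝ) • nabla.torsion x u (Y x) := by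
  simp [symmetrized, CovariantDerivative.addOneForm, sub_eq_add_neg]

theorem nablaJ_tensorial (J : AlmostComplexStructure n M) (nabla : Connection n M) (x : M) :
    TensorialAt (𝓡 n) (EuclideanSpace ℝ (Fin n))
      (fun Y : ∀ x : M, TangentSpace (𝓡 n) x =>
        nabla (fun y => J y (Y y)) x - (J x).comp (nabla Y x)) x := by
  have hJ : ∀ {Y : ∀ x : M, TangentSpace (𝓡 n) x}, 
      MDifferentiableAt (𝓡 n) (𝓡 n).tangent (fun y => (TotalSpace.mk y (Y y) : TangentBundle (𝓡 n) M)) x →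
      
      MDifferentiableAt (𝓡 n) (𝓡 n).tangent (fun y => (TotalSpace.mk y (J y (Y y)) : TangentBundle (𝓡 n) M)) x := fun hY =>
    ((J.smooth x).mdifferentiableAt (by simp)).clm_bundle_apply hY
  constructor
  · intro f Y hf hY
    have h1 : (fun y => J y ((f • Y) y)) = f • (fun y => J y (Y y)) := by
      ext1 y; simp
    simp only [h1]
    rw [nabla.isCovariantDerivativeOnUniv.leibniz (hJ hY) hf,
      nabla.isCovariantDerivativeOnUniv.leibniz hY hf]
    ext1 u
    simp [smul_sub]
  · intro Y Y' hY hY'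
    have h1 : (fun y => J y ((Y + Y') y)) = (fun y => J y (Y y)) + (fun y => J y (Y' y)) := by
      ext1 y; simp
    simp only [h1]
    rw [nabla.isCovariantDerivativeOnUniv.add (hJ hY) (hJ hY'),
      nabla.isCovariantDerivativeOnUniv.add hY hY']
    ext1 u
    simp
    abel

/-- The tensor `∇J`, `(∇J)(X, Y) = ∇_X (JY) - J ∇_X Y`. -/
def nablaJ (J : AlmostComplexStructure n M) (nabla : Connection n M) (x : M) :
    TangentSpace (𝓡 n) x →L[ℝ] TangentSpace (𝓡 n) x →L[ℝ] TangentSpace (𝓡 n) x :=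
  swapArgs (TensorialAt.mkHom _ x (nablaJ_tensorial J nabla x))

theorem nablaJ_apply (J : AlmostComplexStructure n M) (nabla : Connection n M) (x : M)
    (X Y : ∀ x : M, TangentSpace (𝓡 n) x) (hY : 
      MDifferentiableAt (𝓡 n) (𝓡 n).tangent (fun y => (TotalSpace.mk y (Y y) : TangentBundle (𝓡 n) M)) x) :
    nablaJ J nabla x (X x) (Y x) =
      nabla (fun y => J y (Y y)) x (X x) - J x (nabla Y x (X x)) := by
  rw [nablaJ, swapArgs_apply, TensorialAt.mkHom_apply _ hY]
  rfl

/-- The tensor `[∇J]`, `[∇J](X, Y) = -(∇J)(X, Y) + (∇J)(Y, X)`. -/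
def bracketNablaJ (J : AlmostComplexStructure n M) (nabla : Connection n M) (x : M) :
    TangentSpace (𝓡 n) x →L[ℝ] TangentSpace (𝓡 n) x →L[ℝ] TangentSpace (𝓡 n) x :=
  -nablaJ J nabla x + swapArgs (nablaJ J nabla x)

end Base

/-! ### The lifts -/

section Lifts

variable {n : ℕ} {M : Type*} [TopologicalSpace M] [ChartedSpace (EuclideanSpace ℝ (Fin n)) M]
  [IsManifold (𝓡 n) ∞ M]

variable (n M) in
/-- Fields of endomorphisms of the tangent spaces of `T*M`. -/
abbrev EndField : Type _ :=
  ∀ ξ : CotangentBundle n M, TangentSpace (cotModel n) ξ →L[ℝ] TangentSpace (cotModel n) ξ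

/-- `K` satisfies the identity `d(θ(J)) = ω(K ·, ·)` that defines the complete lift of `J`. -/
def IsCompleteLift (J : AlmostComplexStructure n M) (K : EndField n M) : Prop :=
  ∀ (ξ : CotangentBundle n M) (Y Z : TangentSpace (cotModel n) ξ),
    extDerivOneForm (cotModel n) (thetaForm (n := n) (M := M) J) ξ Y Z = omegaSt ξ (K ξ Y) Z

/-- The complete lift `Jᶜ`: the field determined by `d(θ(J)) = ω(Jᶜ ·, ·)`. -/
def completeLift (J : AlmostComplexStructure n M) : EndField n M :=
  Classical.epsilon (IsCompleteLift J)

/-- The horizontal lift `J^{H,∇} = Jᶜ + γ([∇̃J])` of Ishihara and Yano. -/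
def horizontalLift (J : AlmostComplexStructure n M) (nabla : Connection n M) : EndField n M :=
  fun ξ => completeLift J ξ + gammaContraction (bracketNablaJ J (symmetrized nabla)) ξ

/-- The connection induced on `T*M`: the value at `x` of `(∇_X s)(Y) = X.s(Y) - s(∇_X Y)`, where
`u` is the value of `X` at `x`. -/
def dualCov (nabla : Connection n M) (s : ∀ x : M, CotangentSpace n x)
    (Y : ∀ x : M, TangentSpace (𝓡 n) x) (x : M) (u : TangentSpace (𝓡 n) x) : ℝ :=
  mvfderiv (𝓡 n) (fun y => (s y (Y y) : ℝ)) x u - s x (nabla Y x u)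

/-- The horizontal distribution of `∇`:
`H_ξ = {dₓs(X) | X ∈ TₓM, s ∈ Γ(T*M), s(x) = ξ, ∇_X s = 0}`, where `x = π(ξ)`. -/
def horizontalSpace (nabla : Connection n M) (ξ : CotangentBundle n M) :
    Set (TangentSpace (cotModel n) ξ) :=
  {Z | ∃ (s : ∀ x : M, CotangentSpace n x) (u : TangentSpace (𝓡 n) ξ.proj),
    ContMDiff (𝓡 n) (cotModel n) ∞ (fun x => (TotalSpace.mk x (s x) : CotangentBundle n M)) ∧
    (∀ Y : ∀ x : M, TangentSpace (𝓡 n) x,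
      ContMDiff (𝓡 n) (𝓡 n).tangent ∞ (fun x => (TotalSpace.mk x (Y x) : TangentBundle (𝓡 n) M)) →
      dualCov nabla s Y ξ.proj u = 0) ∧
    tangentMap (𝓡 n) (cotModel n) (fun x => (TotalSpace.mk x (s x) : CotangentBundle n M))
      ⟨ξ.proj, u⟩ = ⟨ξ, Z⟩}

/-- `K` is the product structure `J ⊕ ᵗJ` with respect to the decompositions
`T_ξ T*M = H_ξ ⊕ T*ₓM`, `x = π(ξ)`: it maps `h + α` to `h' + α ∘ J`, where `h'` is the horizontal
vector with `dπ h' = J (dπ h)`. -/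
def IsGeneralizedHorizontalLift (J : AlmostComplexStructure n M) (nabla : Connection n M)
    (K : EndField n M) : Prop :=
  ∀ ξ : CotangentBundle n M, ∀ h ∈ horizontalSpace nabla ξ, ∀ h' ∈ horizontalSpace nabla ξ,
    dπ ξ h' = J ξ.proj (dπ ξ h) → ∀ α : CotangentSpace n ξ.proj,
      K ξ (h + vert ξ α) = h' + vert ξ (α.comp (J ξ.proj))

/-- The generalized horizontal lift `J^{G,∇}`. -/
def generalizedHorizontalLift (J : AlmostComplexStructure n M) (nabla : Connection n M) :
    EndField n M :=
  Classical.epsilon (IsGeneralizedHorizontalLift J nabla)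

end Lifts

end CotangentLift

end

/-! Both lifts are computed at each `ξ` over `x` in the charts centred there. At the centre, the
preferred trivialization of `TM` at `x` is the identity, and so is the derivative of the chart of
`T*M` at `ξ`. Hence `TₓM` is literally `E = ℝⁿ`, `T_ξ T*M` is `E × E*`, `dπ` is the first projection
and vertical vectors are the pairs `(0, α)`. Derivatives of fields at the centre are ordinary
Fréchet derivatives of their readings.

Write `∂J` for the derivative of `J` in the chart and `Γ` for the Christoffel symbols of `∇̃`, with
`∇̃_u Y = ∂_u Y + Γ(Y, u)`. The form `θ(J)` reads `p ∘ J(y) ∘ dy`. Its differential and the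
nondegenerate form `ω(v, w) = v₂(w₁) - w₂(v₁)` force `Jᶜ(v, q) = (Jv, q ∘ J + ξ(∂J(v, ·) - ∂J(·,
v)))` (`isCompleteLift_iff`). The horizontal space is the graph of `u ↦ ξ(Γ(·, u))`
(`mem_horizontalSpace_iff`), a complement of the vertical space, which forces `J^G(v, q) = (Jv, q ∘
J + ξ(Γ(·, Jv)) - ξ(Γ(J·, v)))` (`isGeneralizedHorizontalLift_iff`). Each formula gives existence
and uniqueness together.

Subtracting half the torsion makes `Γ` symmetric (`christoffel_symmetrized_comm`). In `[∇̃J](v, w)`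
the two terms `J Γ` therefore cancel, and what remains is `-∂J(v, w) + ∂J(w, v) + Γ(Jv, w) - Γ(Jw,
v)`. Adding its contraction with `ξ` to `Jᶜ` removes `∂J` and leaves exactly `J^G`. -/

noncomputable section

namespace CotangentLift

/-! ### Fields read in the preferred trivialization. -/

section Reading

variable {n : ℕ} {M : Type*} [TopologicalSpace M] [ChartedSpace (EuclideanSpace ℝ (Fin n)) M]
  [IsManifold (𝓡 n) ∞ M]

/-- A vector field read in the preferred trivialization at `x₀`. -/
def vecRead (x₀ : M) (Y : ∀ x : M, TangentSpace (𝓡 n) x) : M → EuclideanSpace ℝ (Fin n) := fun m =>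
  (trivializationAt (EuclideanSpace ℝ (Fin n)) (TangentSpace (𝓡 n)) x₀).continuousLinearMapAt ℝ m
    (Y m)

/-- A field of endomorphisms read in the preferred trivialization at `x₀`. -/
def endRead (x₀ : M) (R : ∀ x : M, TangentSpace (𝓡 n) x →L[ℝ] TangentSpace (𝓡 n) x) :
    M → EuclideanSpace ℝ (Fin n) →L[ℝ] EuclideanSpace ℝ (Fin n) := fun m =>
  ContinuousLinearMap.inCoordinates (EuclideanSpace ℝ (Fin n)) (TangentSpace (𝓡 n) : M → Type)
    (EuclideanSpace ℝ (Fin n)) (TangentSpace (𝓡 n) : M → Type) x₀ m x₀ m (R m)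

/-- A covector field read in the preferred trivialization at `x₀`. -/
def covRead (x₀ : M) (s : ∀ x : M, CotangentSpace n x) : M → Dual n := fun m =>
  (trivializationAt (Dual n) (CotangentSpace n : M → Type) x₀ ⟨m, s m⟩).2

/-- The coordinate change from a chart to itself is the identity. The statement typechecks because
`TangentSpace` is definitionally the model space; every later identification at a centre rests on
this. -/
theorem triv_self (x : M) (v : TangentSpace (𝓡 n) x) :
    (trivializationAt (EuclideanSpace ℝ (Fin n)) (TangentSpace (𝓡 n)) x).continuousLinearMapAt ℝ x
      v = v := by
  rw [TangentBundle.continuousLinearMapAt_trivializationAt_eq_core (by simp)]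
  exact (tangentBundleCore (𝓡 n) M).coordChange_self (achart _ x) x (mem_chart_source _ x) v

theorem triv_symm_self (x : M) (v : EuclideanSpace ℝ (Fin n)) :
    (trivializationAt (EuclideanSpace ℝ (Fin n)) (TangentSpace (𝓡 n)) x).symmL ℝ x v = v := by
  rw [TangentBundle.symmL_trivializationAt_eq_core (by simp)]
  exact (tangentBundleCore (𝓡 n) M).coordChange_self (achart _ x) x (mem_chart_source _ x) v

theorem vecRead_self (x : M) (Y : ∀ x : M, TangentSpace (𝓡 n) x) : vecRead x Y x = Y x :=
  triv_self x (Y x)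

theorem endRead_self (x : M) (R : ∀ x : M, TangentSpace (𝓡 n) x →L[ℝ] TangentSpace (𝓡 n) x)
    (v : EuclideanSpace ℝ (Fin n)) : endRead x R x v = R x v := by
  simp only [endRead, ContinuousLinearMap.inCoordinates, ContinuousLinearMap.comp_apply]
  rw [triv_symm_self]
  exact triv_self x _

theorem covRead_apply (x₀ : M) (s : ∀ x : M, CotangentSpace n x) (m : M)
    (v : EuclideanSpace ℝ (Fin n)) :
    covRead x₀ s m v = s m
      ((trivializationAt (EuclideanSpace ℝ (Fin n)) (TangentSpace (𝓡 n)) x₀).symmL ℝ m v) := by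
  simp only [covRead, hom_trivializationAt_apply, ContinuousLinearMap.inCoordinates]
  simp

theorem covRead_self (x : M) (s : ∀ x : M, CotangentSpace n x) : covRead x s x = s x := by
  refine ContinuousLinearMap.ext fun v => ?_
  rw [covRead_apply, triv_symm_self]
  rfl

theorem mdifferentiableAt_vecRead {x : M} {Y : ∀ x : M, TangentSpace (𝓡 n) x}
    (hY : MDifferentiableAt (𝓡 n) (𝓡 n).tangent
      (fun y => (TotalSpace.mk y (Y y) : TangentBundle (𝓡 n) M)) x) :
    MDifferentiableAt (𝓡 n) 𝓘(ℝ, EuclideanSpace ℝ (Fin n)) (vecRead x Y) x := by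
  have h := ((mdifferentiableAt_totalSpace (𝓡 n) _).1 hY).2
  refine h.congr_of_eventuallyEq ?_
  filter_upwards [(trivializationAt (EuclideanSpace ℝ (Fin n)) (TangentSpace (𝓡 n))
    x).open_baseSet.mem_nhds (mem_baseSet_trivializationAt' x)] with m hm
  simp [vecRead, Trivialization.coe_linearMapAt_of_mem _ hm]

theorem mdifferentiableAt_endRead {x : M}
    {R : ∀ x : M, TangentSpace (𝓡 n) x →L[ℝ] TangentSpace (𝓡 n) x}
    (hR : MDifferentiableAt (𝓡 n)
    ((𝓡 n).prod 𝓘(ℝ, EuclideanSpace ℝ (Fin n) →L[ℝ] EuclideanSpace ℝ (Fin n)))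
    (fun x => TotalSpace.mk' (EuclideanSpace ℝ (Fin n) →L[ℝ] EuclideanSpace ℝ (Fin n))
      (E := fun y : M => TangentSpace (𝓡 n) y →L[ℝ] TangentSpace (𝓡 n) y) x (R x)) x) :
    MDifferentiableAt (𝓡 n) 𝓘(ℝ, EuclideanSpace ℝ (Fin n) →L[ℝ] EuclideanSpace ℝ (Fin n))
      (endRead x R) x :=
  ((mdifferentiableAt_hom_bundle _).1 hR).2

theorem vecRead_end_apply (x : M) (R : ∀ x : M, TangentSpace (𝓡 n) x →L[ℝ] TangentSpace (𝓡 n) x)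
    (Y : ∀ x : M, TangentSpace (𝓡 n) x) {m : M}
    (hm : m ∈ (chartAt (EuclideanSpace ℝ (Fin n)) x).source) :
    vecRead x (fun y => R y (Y y)) m = endRead x R m (vecRead x Y m) := by
  simp only [vecRead, endRead, ContinuousLinearMap.inCoordinates, ContinuousLinearMap.comp_apply]
  rw [Trivialization.symmL_continuousLinearMapAt]
  simpa using hm

theorem covRead_vecRead (x : M) (s : ∀ x : M, CotangentSpace n x)
    (Y : ∀ x : M, TangentSpace (𝓡 n) x) {m : M}
    (hm : m ∈ (chartAt (EuclideanSpace ℝ (Fin n)) x).source) :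
    covRead x s m (vecRead x Y m) = s m (Y m) := by
  rw [covRead_apply, vecRead, Trivialization.symmL_continuousLinearMapAt]
  simpa using hm

end Reading

/-! ### Christoffel symbols, torsion and `∇J` at the centre of a chart. -/

section Christoffel

variable {n : ℕ} {M : Type*} [TopologicalSpace M] [ChartedSpace (EuclideanSpace ℝ (Fin n)) M]
  [IsManifold (𝓡 n) ∞ M]

/-- The derivative at `x` of a function on `M`, as a linear map on the model space. -/
def chartDeriv {F : Type*} [NormedAddCommGroup F] [NormedSpace ℝ F] (x : M) (f : M → F) :
    EuclideanSpace ℝ (Fin n) →L[ℝ] F :=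
  mvfderiv (𝓡 n) f x

/-- The derivative at `x` of a vector field read in the preferred trivialization at `x`. -/
def vecDeriv (x : M) (Y : ∀ x : M, TangentSpace (𝓡 n) x) :
    TangentSpace (𝓡 n) x →L[ℝ] TangentSpace (𝓡 n) x :=
  chartDeriv x (vecRead x Y)

/-- The derivative at `x` of a field of endomorphisms read in the preferred trivialization at
`x`. -/
def endDeriv (x : M) (R : ∀ x : M, TangentSpace (𝓡 n) x →L[ℝ] TangentSpace (𝓡 n) x) :
    TangentSpace (𝓡 n) x →L[ℝ] TangentSpace (𝓡 n) x →L[ℝ] TangentSpace (𝓡 n) x :=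
  chartDeriv x (endRead x R)

theorem vecDeriv_add {x : M} {Y Z : ∀ x : M, TangentSpace (𝓡 n) x}
    (hY : MDifferentiableAt (𝓡 n) (𝓡 n).tangent
      (fun y => (TotalSpace.mk y (Y y) : TangentBundle (𝓡 n) M)) x)
    (hZ : MDifferentiableAt (𝓡 n) (𝓡 n).tangent
      (fun y => (TotalSpace.mk y (Z y) : TangentBundle (𝓡 n) M)) x) :
    vecDeriv x (Y + Z) = vecDeriv x Y + vecDeriv x Z := by
  have h : vecRead x (Y + Z) = vecRead x Y + vecRead x Z := by
    ext1 m
    exact map_add ((trivializationAt (EuclideanSpace ℝ (Fin n)) (TangentSpace (𝓡 n))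
      x).continuousLinearMapAt ℝ m) _ _
  rw [vecDeriv, h]
  exact mvfderiv_add (mdifferentiableAt_vecRead hY) (mdifferentiableAt_vecRead hZ)

theorem vecDeriv_smul {x : M} {f : M → ℝ} {Y : ∀ x : M, TangentSpace (𝓡 n) x}
    (hf : MDifferentiableAt (𝓡 n) 𝓘(ℝ, ℝ) f x)
    (hY : MDifferentiableAt (𝓡 n) (𝓡 n).tangent
      (fun y => (TotalSpace.mk y (Y y) : TangentBundle (𝓡 n) M)) x) (u : TangentSpace (𝓡 n) x) :
    vecDeriv x (f • Y) u = f x • vecDeriv x Y u + mvfderiv (𝓡 n) f x u • Y x := by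
  have h : vecRead x (f • Y) = f • vecRead x Y := by
    ext1 m
    exact map_smul ((trivializationAt (EuclideanSpace ℝ (Fin n)) (TangentSpace (𝓡 n))
      x).continuousLinearMapAt ℝ m) _ _
  have h' := mvfderiv_smul hf (mdifferentiableAt_vecRead hY)
  rw [vecRead_self] at h'
  rw [vecDeriv, h]
  exact congrArg (fun A : EuclideanSpace ℝ (Fin n) →L[ℝ] EuclideanSpace ℝ (Fin n) => A u) h'

omit [IsManifold (𝓡 n) ∞ M] in
/-- The derivative of a differentiable function on `M` is the derivative of its expression in the
preferred chart. -/
theorem hasFDerivAt_comp_extChartAt_symm {F : Type*} [NormedAddCommGroup F] [NormedSpace ℝ F]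
    {f : M → F} {x : M} (hf : MDifferentiableAt (𝓡 n) 𝓘(ℝ, F) f x) :
    HasFDerivAt (fun y => f ((extChartAt (𝓡 n) x).symm y))
      (chartDeriv x f) (extChartAt (𝓡 n) x x) := by
  have h := hf.hasMFDerivAt.2
  rw [ModelWithCorners.Boundaryless.range_eq_univ] at h
  exact hasFDerivWithinAt_univ.1 h

/-- Product rule for the reading of `R Y`, which near `x` is the reading of `R` applied to that of
`Y`. -/
theorem vecDeriv_end_apply {x : M}
    {R : ∀ x : M, TangentSpace (𝓡 n) x →L[ℝ] TangentSpace (𝓡 n) x}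
    {Y : ∀ x : M, TangentSpace (𝓡 n) x}
    (hR : MDifferentiableAt (𝓡 n)
    ((𝓡 n).prod 𝓘(ℝ, EuclideanSpace ℝ (Fin n) →L[ℝ] EuclideanSpace ℝ (Fin n)))
    (fun x => TotalSpace.mk' (EuclideanSpace ℝ (Fin n) →L[ℝ] EuclideanSpace ℝ (Fin n))
      (E := fun y : M => TangentSpace (𝓡 n) y →L[ℝ] TangentSpace (𝓡 n) y) x (R x)) x)
    (hY : MDifferentiableAt (𝓡 n) (𝓡 n).tangent
      (fun y => (TotalSpace.mk y (Y y) : TangentBundle (𝓡 n) M)) x) (u : TangentSpace (𝓡 n) x) :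
    vecDeriv x (fun y => R y (Y y)) u = endDeriv x R u (Y x) + R x (vecDeriv x Y u) := by
  have hRY := hR.clm_bundle_apply hY
  have h1 := hasFDerivAt_comp_extChartAt_symm (mdifferentiableAt_vecRead hRY)
  have h2 := hasFDerivAt_comp_extChartAt_symm (mdifferentiableAt_vecRead hY)
  have h3 := hasFDerivAt_comp_extChartAt_symm (mdifferentiableAt_endRead hR)
  have h4 := h1.unique ((h3.clm_apply h2).congr_of_eventuallyEq (by
    filter_upwards [extChartAt_target_mem_nhds x] with y hy
    exact vecRead_end_apply x R Y (by simpa using (extChartAt (𝓡 n) x).map_target hy)))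
  have h5 := congrArg (fun A : EuclideanSpace ℝ (Fin n) →L[ℝ] EuclideanSpace ℝ (Fin n) => A u) h4
  simp only [extChartAt_to_inv, vecRead_self] at h5
  have h6 : chartDeriv x (vecRead x fun y => R y (Y y)) u =
    endRead x R x (chartDeriv x (vecRead x Y) u) + chartDeriv x (endRead x R) u (Y x) := h5
  rw [endRead_self] at h6
  exact h6.trans (add_comm _ _)

/-- The difference of a connection and of the flat connection of the preferred chart. -/
def connectionForm (D : Connection n M) (x : M) (Y : ∀ x : M, TangentSpace (𝓡 n) x) :
    TangentSpace (𝓡 n) x →L[ℝ] TangentSpace (𝓡 n) x :=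
  D Y x - vecDeriv x Y

/-- Both operators obey the same Leibniz rule, so the terms in the derivative of `f` cancel in the
difference. -/
theorem connectionForm_tensorial (D : Connection n M) (x : M) :
    TensorialAt (𝓡 n) (EuclideanSpace ℝ (Fin n)) (connectionForm D x) x := by
  constructor
  · intro f Y hf hY
    ext1 u
    simp only [connectionForm, D.isCovariantDerivativeOnUniv.leibniz hY hf,
      sub_apply, add_apply, smul_apply,
      ContinuousLinearMap.smulRight_apply, vecDeriv_smul hf hY]
    module
  · intro Y Z hY hZ
    rw [connectionForm, vecDeriv_add hY hZ, D.isCovariantDerivativeOnUniv.add hY hZ]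
    exact add_sub_add_comm _ _ _ _

/-- The Christoffel symbols of a connection at the centre of the preferred chart at `x`. -/
def christoffel (D : Connection n M) (x : M) :
    TangentSpace (𝓡 n) x →L[ℝ] TangentSpace (𝓡 n) x →L[ℝ] TangentSpace (𝓡 n) x :=
  TensorialAt.mkHom _ x (connectionForm_tensorial D x)

/-- Fixes the order of arguments: the first argument of `christoffel` is the value of the field, the
second the direction of differentiation. -/
theorem connection_apply (D : Connection n M) {x : M} {Y : ∀ x : M, TangentSpace (𝓡 n) x}
    (hY : MDifferentiableAt (𝓡 n) (𝓡 n).tangent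
      (fun y => (TotalSpace.mk y (Y y) : TangentBundle (𝓡 n) M)) x) (u : TangentSpace (𝓡 n) x) :
    D Y x u = vecDeriv x Y u + christoffel D x (Y x) u := by
  rw [christoffel, TensorialAt.mkHom_apply _ hY, connectionForm, sub_apply]
  abel

/-- The derivative of the inverse chart is the inverse of the trivialization, so inverting it gives
the trivialization itself. This links the definition of the Lie bracket to `vecRead`. -/
theorem mpullbackWithin_eq_vecRead (x : M) (Y : ∀ x : M, TangentSpace (𝓡 n) x)
    {y : EuclideanSpace ℝ (Fin n)} (hy : y ∈ (extChartAt (𝓡 n) x).target) :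
    VectorField.mpullbackWithin 𝓘(ℝ, EuclideanSpace ℝ (Fin n)) (𝓡 n) (extChartAt (𝓡 n) x).symm Y
      (Set.range (𝓡 n)) y = vecRead x Y ((extChartAt (𝓡 n) x).symm y) := by
  have hm := (extChartAt (𝓡 n) x).map_target hy
  rw [extChartAt_source] at hm
  have hb : (extChartAt (𝓡 n) x).symm y ∈ (trivializationAt (EuclideanSpace ℝ (Fin n))
      (TangentSpace (𝓡 n)) x).baseSet := by simpa using hm
  have h := TangentBundle.symmL_trivializationAt (I := 𝓡 n) hm
  have h' : (mfderivWithin 𝓘(ℝ, EuclideanSpace ℝ (Fin n)) (𝓡 n) (extChartAt (𝓡 n) x).symm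
      (Set.range (𝓡 n)) y : EuclideanSpace ℝ (Fin n) →L[ℝ] EuclideanSpace ℝ (Fin n)) =
      (trivializationAt (EuclideanSpace ℝ (Fin n)) (TangentSpace (𝓡 n)) x).symmL ℝ
        ((extChartAt (𝓡 n) x).symm y) := by
    -- The target type of the derivative depends on its base point, so the equality `φ (φ⁻¹ y) = y`
    -- is transported by substitution rather than rewritten.
    have hz : ∀ z, z = y → (mfderivWithin 𝓘(ℝ, EuclideanSpace ℝ (Fin n)) (𝓡 n)
        (extChartAt (𝓡 n) x).symm (Set.range (𝓡 n)) z :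
          EuclideanSpace ℝ (Fin n) →L[ℝ] EuclideanSpace ℝ (Fin n)) =
        mfderivWithin 𝓘(ℝ, EuclideanSpace ℝ (Fin n)) (𝓡 n)
          (extChartAt (𝓡 n) x).symm (Set.range (𝓡 n)) y := by
      rintro _ rfl
      rfl
    exact (hz _ ((extChartAt (𝓡 n) x).right_inv hy)).symm.trans h.symm
  rw [VectorField.mpullbackWithin_apply, vecRead]
  have h2 : (mfderivWithin 𝓘(ℝ, EuclideanSpace ℝ (Fin n)) (𝓡 n) (extChartAt (𝓡 n) x).symm
      (Set.range (𝓡 n)) y : EuclideanSpace ℝ (Fin n) →L[ℝ] EuclideanSpace ℝ (Fin n)).inverse =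
      (trivializationAt (EuclideanSpace ℝ (Fin n)) (TangentSpace (𝓡 n)) x).continuousLinearMapAt ℝ
        ((extChartAt (𝓡 n) x).symm y) := by
    rw [h']
    refine ContinuousLinearMap.inverse_eq ?_ ?_
    · ext1 v
      exact Trivialization.symmL_continuousLinearMapAt _ hb v
    · ext1 v
      exact Trivialization.continuousLinearMapAt_symmL _ hb v
  exact congrArg (fun A : EuclideanSpace ℝ (Fin n) →L[ℝ] EuclideanSpace ℝ (Fin n) =>
    A (Y ((extChartAt (𝓡 n) x).symm y))) h2

theorem mlieBracket_eq {x : M} {X Y : ∀ x : M, TangentSpace (𝓡 n) x}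
    (hX : MDifferentiableAt (𝓡 n) (𝓡 n).tangent
      (fun y => (TotalSpace.mk y (X y) : TangentBundle (𝓡 n) M)) x)
    (hY : MDifferentiableAt (𝓡 n) (𝓡 n).tangent
      (fun y => (TotalSpace.mk y (Y y) : TangentBundle (𝓡 n) M)) x) :
    VectorField.mlieBracket (𝓡 n) X Y x = vecDeriv x Y (X x) - vecDeriv x X (Y x) := by
  let pull (Z : ∀ x : M, TangentSpace (𝓡 n) x) :
      EuclideanSpace ℝ (Fin n) → EuclideanSpace ℝ (Fin n) :=
    VectorField.mpullbackWithin 𝓘(ℝ, EuclideanSpace ℝ (Fin n)) (𝓡 n)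
        (extChartAt (𝓡 n) x).symm Z (Set.range (𝓡 n))
  have key : ∀ {Z : ∀ x : M, TangentSpace (𝓡 n) x}, MDifferentiableAt (𝓡 n) (𝓡 n).tangent
      (fun y => (TotalSpace.mk y (Z y) : TangentBundle (𝓡 n) M)) x →
      HasFDerivAt (pull Z)
        (chartDeriv x (vecRead x Z))
        (extChartAt (𝓡 n) x x) := by
    intro Z hZ
    refine (hasFDerivAt_comp_extChartAt_symm
      (mdifferentiableAt_vecRead hZ)).congr_of_eventuallyEq ?_
    filter_upwards [extChartAt_target_mem_nhds x] with y hy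
    exact mpullbackWithin_eq_vecRead x Z hy
  have key' (Z : ∀ x : M, TangentSpace (𝓡 n) x) : pull Z (extChartAt (𝓡 n) x x) = Z x :=
    (mpullbackWithin_eq_vecRead x Z (mem_extChartAt_target x)).trans
        ((congrArg (vecRead x Z) (extChartAt_to_inv x)).trans (vecRead_self x Z))
  let A : EuclideanSpace ℝ (Fin n) →L[ℝ] EuclideanSpace ℝ (Fin n) :=
    mfderiv (𝓡 n) 𝓘(ℝ, EuclideanSpace ℝ (Fin n)) (extChartAt (𝓡 n) x) x
  have h0 : VectorField.mlieBracket (𝓡 n) X Y x =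
      A.inverse (VectorField.lieBracketWithin ℝ (pull X) (pull Y)
          ((extChartAt (𝓡 n) x).symm ⁻¹' Set.univ ∩ Set.range (𝓡 n)) (extChartAt (𝓡 n) x x)) := rfl
  have h1 : A = ContinuousLinearMap.id ℝ (EuclideanSpace ℝ (Fin n)) := mfderiv_extChartAt_self
  rw [h0, h1, ContinuousLinearMap.inverse_id, Set.preimage_univ,
    ModelWithCorners.Boundaryless.range_eq_univ, Set.univ_inter,
    VectorField.lieBracketWithin_univ, ContinuousLinearMap.id_apply, VectorField.lieBracket_eq]
  have h2 : fderiv ℝ (pull Y) (extChartAt (𝓡 n) x x) (pull X (extChartAt (𝓡 n) x x)) -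
      fderiv ℝ (pull X) (extChartAt (𝓡 n) x x) (pull Y (extChartAt (𝓡 n) x x)) =
      chartDeriv x (vecRead x Y) (X x) - chartDeriv x (vecRead x X) (Y x) := by
    rw [(key hX).fderiv, (key hY).fderiv, key', key']
  exact h2

/-- The flat derivatives of the two extended fields are exactly cancelled by their Lie bracket. -/
theorem torsion_eq_christoffel (D : Connection n M) (x : M) (u v : TangentSpace (𝓡 n) x) :
    D.torsion x u v = christoffel D x v u - christoffel D x u v := by
  have hu := mdifferentiableAt_extend (𝓡 n) (EuclideanSpace ℝ (Fin n)) u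
  have hv := mdifferentiableAt_extend (𝓡 n) (EuclideanSpace ℝ (Fin n)) v
  have h := D.torsion_apply hu hv
  rw [connection_apply D hu, connection_apply D hv, mlieBracket_eq hu hv] at h
  simp only [extend_apply_self] at h
  rw [h]
  abel

/-- Half the torsion is the antisymmetric part of the Christoffel symbols; subtracting it leaves the
symmetric part. -/
theorem christoffel_symmetrized (D : Connection n M) (x : M) (u v : TangentSpace (𝓡 n) x) :
    christoffel (symmetrized D) x v u =
      (1 / 2 : ℝ) • (christoffel D x v u + christoffel D x u v) := by
  have hv := mdifferentiableAt_extend (𝓡 n) (EuclideanSpace ℝ (Fin n)) v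
  have h := symmetrized_apply D (extend (EuclideanSpace ℝ (Fin n)) v) x u
  rw [connection_apply _ hv, connection_apply D hv, torsion_eq_christoffel] at h
  simp only [extend_apply_self] at h
  rw [← sub_eq_zero] at h ⊢
  rw [← h]
  module

theorem christoffel_symmetrized_comm (D : Connection n M) (x : M) (u v : TangentSpace (𝓡 n) x) :
    christoffel (symmetrized D) x u v = christoffel (symmetrized D) x v u := by
  rw [christoffel_symmetrized, christoffel_symmetrized, add_comm]

theorem nablaJ_eq (J : AlmostComplexStructure n M) (D : Connection n M) (x : M)
    (u v : TangentSpace (𝓡 n) x) :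
    nablaJ J D x u v =
      endDeriv x J u v + christoffel D x (J x v) u - J x (christoffel D x v u) := by
  have hJ := (J.smooth x).mdifferentiableAt (by simp)
  have hv := mdifferentiableAt_extend (𝓡 n) (EuclideanSpace ℝ (Fin n)) v
  have hJv := hJ.clm_bundle_apply hv
  have h := nablaJ_apply J D x (extend (EuclideanSpace ℝ (Fin n)) u) _ hv
  rw [connection_apply _ hJv, connection_apply D hv, vecDeriv_end_apply hJ hv, map_add] at h
  simp only [extend_apply_self] at h
  rw [h]
  abel

end Christoffel

/-! ### The chart of `T*M` centred at a covector. -/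

section CotangentChart

variable {n : ℕ} {M : Type*} [TopologicalSpace M] [ChartedSpace (EuclideanSpace ℝ (Fin n)) M]
  [IsManifold (𝓡 n) ∞ M]

theorem extChartAt_cotangentBundle (ξ ζ : CotangentBundle n M) :
    extChartAt (cotModel n) ξ ζ = (extChartAt (𝓡 n) ξ.proj ζ.proj,
      (trivializationAt (Dual n) (CotangentSpace n : M → Type) ξ.proj ζ).2) := by
  rw [FiberBundle.extChartAt]
  rfl

theorem cotangent_triv_apply (x₀ : M) (ζ : CotangentBundle n M) (v : EuclideanSpace ℝ (Fin n)) :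
    (trivializationAt (Dual n) (CotangentSpace n : M → Type) x₀ ζ).2 v = ζ.snd
      ((trivializationAt (EuclideanSpace ℝ (Fin n)) (TangentSpace (𝓡 n)) x₀).symmL ℝ ζ.proj v) := by
  simp only [hom_trivializationAt_apply, ContinuousLinearMap.inCoordinates]
  simp

theorem cotangent_triv_self (x : M) (p : CotangentSpace n x) :
    (trivializationAt (Dual n) (CotangentSpace n : M → Type) x ⟨x, p⟩).2 = p := by
  refine ContinuousLinearMap.ext fun v => ?_
  rw [cotangent_triv_apply, triv_symm_self]
  rfl

theorem mem_extChartAt_cotangentBundle_source {ξ ζ : CotangentBundle n M} :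
    ζ ∈ (extChartAt (cotModel n) ξ).source ↔
      ζ.proj ∈ (chartAt (EuclideanSpace ℝ (Fin n)) ξ.proj).source := by
  rw [FiberBundle.extChartAt]
  simp
  exact fun h => h

/-- Differentiates the identity `φ ∘ π = fst ∘ ψ`, where `φ` and `ψ` are the charts of `M` and
`T*M`. It is needed at every `ζ` over the chart domain, since the forms are differentiated
afterwards. -/
theorem mfderiv_extChartAt_dπ {ξ ζ : CotangentBundle n M}
    (h : ζ.proj ∈ (chartAt (EuclideanSpace ℝ (Fin n)) ξ.proj).source)
    (v : TangentSpace (cotModel n) ζ) :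
    (trivializationAt (EuclideanSpace ℝ (Fin n)) (TangentSpace (𝓡 n))
      ξ.proj).continuousLinearMapAt ℝ ζ.proj (dπ ζ v) =
      (mfderiv (cotModel n) 𝓘(ℝ, EuclideanSpace ℝ (Fin n) × Dual n)
        (extChartAt (cotModel n) ξ) ζ v : EuclideanSpace ℝ (Fin n) × Dual n).1 := by
  have hζ : ζ ∈ (extChartAt (cotModel n) ξ).source := mem_extChartAt_cotangentBundle_source.2 h
  have hψ : MDifferentiableAt (cotModel n) 𝓘(ℝ, EuclideanSpace ℝ (Fin n) × Dual n)
      (extChartAt (cotModel n) ξ) ζ := mdifferentiableAt_extChartAt (by simpa using hζ)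
  have hπ : MDifferentiableAt (cotModel n) (𝓡 n)
      (TotalSpace.proj : CotangentBundle n M → M) ζ := mdifferentiableAt_proj _
  have hφ : MDifferentiableAt (𝓡 n) 𝓘(ℝ, EuclideanSpace ℝ (Fin n)) (extChartAt (𝓡 n) ξ.proj)
      ζ.proj := mdifferentiableAt_extChartAt h
  have h1 := hφ.hasMFDerivAt.comp ζ hπ.hasMFDerivAt
  have hfst : HasMFDerivAt 𝓘(ℝ, EuclideanSpace ℝ (Fin n) × Dual n)
      𝓘(ℝ, EuclideanSpace ℝ (Fin n)) Prod.fst (extChartAt (cotModel n) ξ ζ)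
      (ContinuousLinearMap.fst ℝ (EuclideanSpace ℝ (Fin n)) (Dual n)) :=
    hasFDerivAt_fst.hasMFDerivAt
  have h2 := hfst.comp ζ hψ.hasMFDerivAt
  have h3 : (extChartAt (𝓡 n) ξ.proj ∘ (TotalSpace.proj : CotangentBundle n M → M)) =
      (Prod.fst ∘ extChartAt (cotModel n) ξ) := by
    ext1 ζ
    exact (congrArg Prod.fst (extChartAt_cotangentBundle ξ ζ)).symm
  rw [h3] at h1
  rw [TangentBundle.continuousLinearMapAt_trivializationAt h]
  have h4 := hasMFDerivAt_unique h1 h2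
  exact congrArg (fun A : EuclideanSpace ℝ (Fin n) × Dual n →L[ℝ] EuclideanSpace ℝ (Fin n) => A v) h4

theorem dπ_apply (ξ : CotangentBundle n M) (v : EuclideanSpace ℝ (Fin n) × Dual n) :
    dπ ξ (v : TangentSpace (cotModel n) ξ) = v.1 := by
  have h := mfderiv_extChartAt_dπ (ξ := ξ) (ζ := ξ) (mem_chart_source _ _) v
  rw [triv_self, mfderiv_extChartAt_self] at h
  exact h

/-- In the chart at `ξ` the inclusion of the fibre over `x` is `r ↦ (φ x, r)`, because the
trivialization at `x` is the identity over `x`. -/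
theorem vert_apply (ξ : CotangentBundle n M) (p : CotangentSpace n ξ.proj) :
    vert ξ p = ((0, p) : EuclideanSpace ℝ (Fin n) × Dual n) := by
  obtain ⟨x, q⟩ := ξ
  let f : Dual n → CotangentBundle n M := fun p => TotalSpace.mk x p
  have hf : MDifferentiableAt 𝓘(ℝ, Dual n) (cotModel n) f q := by
    refine (mdifferentiableAt_totalSpace (𝓡 n) _).2 ⟨mdifferentiableAt_const, ?_⟩
    refine MDifferentiableAt.congr_of_eventuallyEq mdifferentiableAt_id
      (Filter.Eventually.of_forall fun r => cotangent_triv_self x r)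
  have hψ : MDifferentiableAt (cotModel n) 𝓘(ℝ, EuclideanSpace ℝ (Fin n) × Dual n)
      (extChartAt (cotModel n) (f q)) (f q) := mdifferentiableAt_extChartAt (mem_chart_source _ _)
  have h2 : extChartAt (cotModel n) (f q) ∘ f = fun r => (extChartAt (𝓡 n) x x, r) := by
    ext1 r
    exact (extChartAt_cotangentBundle (f q) (f r)).trans
      (congrArg (Prod.mk (extChartAt (𝓡 n) x x)) (cotangent_triv_self x r))
  let q' : Dual n := q
  have h3 : HasMFDerivAt 𝓘(ℝ, Dual n) 𝓘(ℝ, EuclideanSpace ℝ (Fin n) × Dual n)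
      (fun r : Dual n => (extChartAt (𝓡 n) x x, r)) q'
      (ContinuousLinearMap.inr ℝ (EuclideanSpace ℝ (Fin n)) (Dual n)) :=
    HasFDerivAt.hasMFDerivAt (hasFDerivAt_prodMk_right (𝕜 := ℝ) (extChartAt (𝓡 n) x x) q')
  have h1 := HasMFDerivAt.comp q' hψ.hasMFDerivAt hf.hasMFDerivAt
  erw [h2, mfderiv_extChartAt_self] at h1
  exact congrArg (fun A : Dual n →L[ℝ] EuclideanSpace ℝ (Fin n) × Dual n => A p)
    (hasMFDerivAt_unique h1 h3)

theorem mfderiv_section {s : ∀ x : M, CotangentSpace n x} {x : M}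
    (hs : MDifferentiableAt (𝓡 n) (cotModel n)
      (fun x => (TotalSpace.mk x (s x) : CotangentBundle n M)) x) (u : TangentSpace (𝓡 n) x) :
    mfderiv (𝓡 n) (cotModel n) (fun x => (TotalSpace.mk x (s x) : CotangentBundle n M)) x u =
      ((u, chartDeriv x (covRead x s) u) : EuclideanSpace ℝ (Fin n) × Dual n) := by
  let f : M → CotangentBundle n M := fun x => TotalSpace.mk x (s x)
  have hφ : MDifferentiableAt (𝓡 n) 𝓘(ℝ, EuclideanSpace ℝ (Fin n)) (extChartAt (𝓡 n) x)
      x := mdifferentiableAt_extChartAt (mem_chart_source _ _)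
  have hψ : MDifferentiableAt (cotModel n) 𝓘(ℝ, EuclideanSpace ℝ (Fin n) × Dual n)
      (extChartAt (cotModel n) (f x)) (f x) := mdifferentiableAt_extChartAt (mem_chart_source _ _)
  have h1 := hψ.hasMFDerivAt.comp (f := f) x hs.hasMFDerivAt
  have h2 : extChartAt (cotModel n) (f x) ∘ f =
      fun m => (extChartAt (𝓡 n) x m, covRead x s m) := by
    ext1 m
    exact extChartAt_cotangentBundle _ _
  have hc : MDifferentiableAt (𝓡 n) 𝓘(ℝ, Dual n) (covRead x s) x :=
    ((mdifferentiableAt_totalSpace (𝓡 n) _).1 hs).2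
  have h3 := (show HasMFDerivAt (𝓡 n) 𝓘(ℝ, EuclideanSpace ℝ (Fin n) × Dual n)
      (fun m => (extChartAt (𝓡 n) x m, covRead x s m)) x _ from
    ⟨hφ.continuousAt.prodMk hc.continuousAt, hφ.hasMFDerivAt.2.prodMk hc.hasMFDerivAt.2⟩)
  rw [h2, mfderiv_extChartAt_self] at h1
  rw [mfderiv_extChartAt_self] at h3
  exact congrArg (fun A : EuclideanSpace ℝ (Fin n) →L[ℝ] EuclideanSpace ℝ (Fin n) × Dual n => A u)
    (hasMFDerivAt_unique h1 h3)

end CotangentChart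

/-! ### The differential of `θ(R)` in coordinates. -/

section OneForm

variable {n : ℕ} {M : Type*} [TopologicalSpace M] [ChartedSpace (EuclideanSpace ℝ (Fin n)) M]
  [IsManifold (𝓡 n) ∞ M]

/-- Over the whole chart the base part of a tangent vector is read through the trivialization, so
`θ(R)` becomes `p ∘ R(y) ∘ dy`, to which `extDeriv_pairing` applies. -/
theorem oneFormInChart_thetaForm (R : ∀ x : M, TangentSpace (𝓡 n) x →L[ℝ] TangentSpace (𝓡 n) x)
    (ξ : CotangentBundle n M) {z : EuclideanSpace ℝ (Fin n) × Dual n}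
    (hz : z ∈ (extChartAt (cotModel n) ξ).target) :
    oneFormInChart (cotModel n) (thetaForm (n := n) (M := M) R) ξ z =
      ContinuousAlternatingMap.ofSubsingleton ℝ (EuclideanSpace ℝ (Fin n) × Dual n) ℝ (0 : Fin 1)
        ((z.2.comp (endRead ξ.proj R ((extChartAt (𝓡 n) ξ.proj).symm z.1))).comp
          (ContinuousLinearMap.fst ℝ (EuclideanSpace ℝ (Fin n)) (Dual n))) := by
  obtain ⟨ζ, hζ, rfl⟩ : ∃ ζ ∈ (extChartAt (cotModel n) ξ).source, extChartAt (cotModel n) ξ ζ = z :=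
    ⟨_, (extChartAt (cotModel n) ξ).map_target hz, (extChartAt (cotModel n) ξ).right_inv hz⟩
  have hζ' := mem_extChartAt_cotangentBundle_source.1 hζ
  refine congrArg (ContinuousAlternatingMap.ofSubsingleton ℝ (EuclideanSpace ℝ (Fin n) × Dual n) ℝ
    (0 : Fin 1)) (ContinuousLinearMap.ext fun v => ?_)
  let g : EuclideanSpace ℝ (Fin n) × Dual n →L[ℝ] EuclideanSpace ℝ (Fin n) × Dual n :=
    mfderiv 𝓘(ℝ, EuclideanSpace ℝ (Fin n) × Dual n) (cotModel n)
      (extChartAt (cotModel n) ξ).symm (extChartAt (cotModel n) ξ ζ)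
  have hg : (mfderiv (cotModel n) 𝓘(ℝ, EuclideanSpace ℝ (Fin n) × Dual n)
      (extChartAt (cotModel n) ξ) ζ (g v) : EuclideanSpace ℝ (Fin n) × Dual n) = v := by
    have h := mfderiv_extChartAt_comp_mfderivWithin_extChartAt_symm' hζ
    rw [ModelWithCorners.Boundaryless.range_eq_univ, mfderivWithin_univ] at h
    exact congrArg (fun A : EuclideanSpace ℝ (Fin n) × Dual n →L[ℝ]
      EuclideanSpace ℝ (Fin n) × Dual n => A v) h
  have hb : ζ.proj ∈ (trivializationAt (EuclideanSpace ℝ (Fin n)) (TangentSpace (𝓡 n))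
      ξ.proj).baseSet := by simpa using hζ'
  have hd : dπ ζ (g v) = (trivializationAt (EuclideanSpace ℝ (Fin n)) (TangentSpace (𝓡 n))
      ξ.proj).symmL ℝ ζ.proj v.1 := by
    have h := mfderiv_extChartAt_dπ hζ' (g v)
    rw [hg] at h
    rw [← h, Trivialization.symmL_continuousLinearMapAt _ hb]
  have hl : ∀ η, η = ζ → (thetaForm R η : EuclideanSpace ℝ (Fin n) × Dual n →L[ℝ] ℝ) =
      thetaForm R ζ := by
    rintro _ rfl
    rfl
  have h1 : ((thetaForm R ((extChartAt (cotModel n) ξ).symm (extChartAt (cotModel n) ξ ζ)) :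
      EuclideanSpace ℝ (Fin n) × Dual n →L[ℝ] ℝ)).comp g v =
      ζ.snd (R ζ.proj (dπ ζ (g v))) := by
    rw [hl _ ((extChartAt (cotModel n) ξ).left_inv hζ)]
    rfl
  refine h1.trans ?_
  rw [hd, extChartAt_cotangentBundle]
  simp only [ContinuousLinearMap.comp_apply, ContinuousLinearMap.coe_fst']
  rw [(extChartAt (𝓡 n) ξ.proj).left_inv (by simpa using hζ'), cotangent_triv_apply]
  simp only [endRead, ContinuousLinearMap.inCoordinates, ContinuousLinearMap.comp_apply]
  rw [Trivialization.symmL_continuousLinearMapAt _ hb]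

theorem differentiableAt_ofSubsingleton {V W : Type*} [NormedAddCommGroup V] [NormedSpace ℝ V]
    [NormedAddCommGroup W] [NormedSpace ℝ W] {f : V → W →L[ℝ] ℝ} {z : V}
    (hf : DifferentiableAt ℝ f z) :
    DifferentiableAt ℝ (fun z => ContinuousAlternatingMap.ofSubsingleton ℝ W ℝ (0 : Fin 1) (f z))
      z :=
  (ContinuousAlternatingMap.ofSubsingletonLIE (𝕜 := ℝ) (E := W) (F := ℝ)
    (0 : Fin 1)).toContinuousLinearEquiv.differentiableAt.comp z hf

/-- The exterior derivative of the one-form `(y, p) ↦ p ∘ A(y) ∘ dy`. -/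
theorem extDeriv_pairing {E : Type*} [NormedAddCommGroup E] [NormedSpace ℝ E] {A : E → E →L[ℝ] E}
    {A' : E →L[ℝ] E →L[ℝ] E} {z : E × (E →L[ℝ] ℝ)} (hA : HasFDerivAt A A' z.1)
    (v w : E × (E →L[ℝ] ℝ)) :
    extDeriv (fun z : E × (E →L[ℝ] ℝ) => ContinuousAlternatingMap.ofSubsingleton ℝ
      (E × (E →L[ℝ] ℝ)) ℝ (0 : Fin 1)
        ((z.2.comp (A z.1)).comp (ContinuousLinearMap.fst ℝ E (E →L[ℝ] ℝ)))) z ![v, w] =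
      v.2 (A z.1 w.1) - w.2 (A z.1 v.1) + z.2 (A' v.1 w.1 - A' w.1 v.1) := by
  have h1 : HasFDerivAt (fun z : E × (E →L[ℝ] ℝ) => A z.1)
    (A'.comp (ContinuousLinearMap.fst ℝ E (E →L[ℝ] ℝ))) z := hA.comp z hasFDerivAt_fst
  have h2 : HasFDerivAt (fun z : E × (E →L[ℝ] ℝ) => z.2)
    (ContinuousLinearMap.snd ℝ E (E →L[ℝ] ℝ)) z := hasFDerivAt_snd
  have h3 := (h2.clm_comp h1).clm_comp
    (hasFDerivAt_const (ContinuousLinearMap.fst ℝ E (E →L[ℝ] ℝ)) z)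
  have h5 := fun u : E × (E →L[ℝ] ℝ) => (h3.clm_apply (hasFDerivAt_const u z)).fderiv
  rw [extDeriv_apply]
  · have h6 (i : Fin 2) : (i.removeNth ![v, w] : Fin 1 → _) 0 = ![w, v] i := by
      fin_cases i <;> rfl
    simp only [ContinuousAlternatingMap.ofSubsingleton_apply_apply, h6, h5]
    simp
    ring
  · exact differentiableAt_ofSubsingleton h3.differentiableAt

theorem extDerivOneForm_thetaForm {R : ∀ x : M, TangentSpace (𝓡 n) x →L[ℝ] TangentSpace (𝓡 n) x}
    (ξ : CotangentBundle n M)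
    (hR : MDifferentiableAt (𝓡 n)
    ((𝓡 n).prod 𝓘(ℝ, EuclideanSpace ℝ (Fin n) →L[ℝ] EuclideanSpace ℝ (Fin n)))
    (fun x => TotalSpace.mk' (EuclideanSpace ℝ (Fin n) →L[ℝ] EuclideanSpace ℝ (Fin n))
      (E := fun y : M => TangentSpace (𝓡 n) y →L[ℝ] TangentSpace (𝓡 n) y) x (R x)) ξ.proj)
    (v w : EuclideanSpace ℝ (Fin n) × Dual n) :
    extDerivOneForm (cotModel n) (thetaForm (n := n) (M := M) R) ξ v w =
      v.2 (R ξ.proj w.1) - w.2 (R ξ.proj v.1) +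
        ξ.snd (endDeriv ξ.proj R v.1 w.1 - endDeriv ξ.proj R w.1 v.1) := by
  have h1 := hasFDerivAt_comp_extChartAt_symm (mdifferentiableAt_endRead hR)
  have h2 : extChartAt (cotModel n) ξ ξ = (extChartAt (𝓡 n) ξ.proj ξ.proj, ξ.snd) := by
    rw [extChartAt_cotangentBundle]
    exact congrArg _ (cotangent_triv_self ξ.proj ξ.snd)
  have h3 : oneFormInChart (cotModel n) (thetaForm (n := n) (M := M) R) ξ =ᶠ[nhds
      (extChartAt (cotModel n) ξ ξ)] _ :=
    Filter.eventuallyEq_of_mem (extChartAt_target_mem_nhds ξ)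
      fun z hz => oneFormInChart_thetaForm R ξ hz
  let A : EuclideanSpace ℝ (Fin n) × Dual n →L[ℝ] EuclideanSpace ℝ (Fin n) × Dual n :=
    mfderiv (cotModel n) 𝓘(ℝ, EuclideanSpace ℝ (Fin n) × Dual n) (extChartAt (cotModel n) ξ) ξ
  have hA : A = ContinuousLinearMap.id ℝ _ := mfderiv_extChartAt_self
  have h0 : extDerivOneForm (cotModel n) (thetaForm (n := n) (M := M) R) ξ v w =
      extDeriv (oneFormInChart (cotModel n) (thetaForm (n := n) (M := M) R) ξ)
        (extChartAt (cotModel n) ξ ξ) ![A v, A w] := rfl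
  rw [h0, hA, h3.extDeriv_eq, h2]
  have h4 := extDeriv_pairing (z := (extChartAt (𝓡 n) ξ.proj ξ.proj, ξ.snd)) h1 v w
  refine h4.trans ?_
  simp only [extChartAt_to_inv]
  rw [endRead_self, endRead_self]
  rfl

end OneForm

/-! ### Extension of local sections to global ones. -/

section GlobalSections

/-- A smooth function with values in the model fibre, defined near `x`, is near `x` the expression
of a global smooth section in the preferred trivialization at `x`. -/
theorem exists_contMDiff_section {E : Type*} [NormedAddCommGroup E] [NormedSpace ℝ E]
    [FiniteDimensional ℝ E] {H : Type*} [TopologicalSpace H] {I : ModelWithCorners ℝ E H}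
    {M : Type*} [TopologicalSpace M] [ChartedSpace H M] [IsManifold I ∞ M] [T2Space M]
    {F : Type*} [NormedAddCommGroup F] [NormedSpace ℝ F] {V : M → Type*}
    [TopologicalSpace (TotalSpace F V)] [∀ x, AddCommGroup (V x)] [∀ x, Module ℝ (V x)]
    [∀ x, TopologicalSpace (V x)] [FiberBundle F V] [VectorBundle ℝ F V]
    [ContMDiffVectorBundle ∞ F V I] {x : M} {f : M → F} {u : Set M} (hu : u ∈ nhds x)
    (hf : ContMDiffOn I 𝓘(ℝ, F) ∞ f u) :
    ∃ s : ∀ m, V m, ContMDiff I (I.prod 𝓘(ℝ, F)) ∞ (fun m => (TotalSpace.mk m (s m) :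
        TotalSpace F V)) ∧
      (fun m => (trivializationAt F V x ⟨m, s m⟩).2) =ᶠ[nhds x] f := by
  let e := trivializationAt F V x
  have hx : x ∈ e.baseSet := mem_baseSet_trivializationAt' x
  have hw : interior u ∩ e.baseSet ∈ nhds x :=
    Filter.inter_mem (interior_mem_nhds.2 hu) (e.open_baseSet.mem_nhds hx)
  obtain ⟨χ, -, hχ⟩ := ((SmoothBumpFunction.nhds_basis_tsupport (I := I) x).mem_iff.1 hw)
  -- A bump function equal to one near `x`, supported where both `f` and the trivialization are
  -- available, extends the local section by zero.
  refine ⟨(χ : M → ℝ) • fun m => e.symm m (f m), ?_, ?_⟩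
  · refine ContMDiffOn.smul_section_of_tsupport (u := interior u ∩ e.baseSet)
      χ.contMDiff.contMDiffOn (isOpen_interior.inter e.open_baseSet) hχ ?_
    intro m hm
    refine ContMDiffAt.contMDiffWithinAt ?_
    refine (e.contMDiffAt_section_iff hm.2).2 ?_
    refine ((hf m (interior_subset hm.1)).contMDiffAt
      (mem_interior_iff_mem_nhds.1 hm.1)).congr_of_eventuallyEq ?_
    filter_upwards [e.open_baseSet.mem_nhds hm.2] with y hy
    simp [hy]
  · filter_upwards [χ.eventuallyEq_one, e.open_baseSet.mem_nhds hx] with m hm hb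
    have h1 : ((χ : M → ℝ) • fun m => e.symm m (f m)) m = e.symm m (f m) := by
      change χ m • e.symm m (f m) = _
      rw [hm, Pi.one_apply, one_smul]
    rw [h1]
    exact congrArg Prod.snd (e.apply_mk_symm hb (f m))

end GlobalSections

/-! ### The horizontal distribution in coordinates. -/

section Horizontal

variable {n : ℕ} {M : Type*} [TopologicalSpace M] [ChartedSpace (EuclideanSpace ℝ (Fin n)) M]
  [IsManifold (𝓡 n) ∞ M]

omit [IsManifold (𝓡 n) ∞ M] in
theorem chartDeriv_congr {F : Type*} [NormedAddCommGroup F] [NormedSpace ℝ F] {f g : M → F} {x : M}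
    (h : f =ᶠ[nhds x] g) : chartDeriv (n := n) x f = chartDeriv x g := by
  rw [chartDeriv, chartDeriv, mvfderiv, mvfderiv, h.mfderiv_eq, h.self_of_nhds]

/-- In `X.s(Y) - s(∇_X Y)` the terms `s(∂_u Y)` cancel, so only the value of `Y` at `x` matters. -/
theorem dualCov_eq (D : Connection n M) {s : ∀ x : M, CotangentSpace n x}
    {Y : ∀ x : M, TangentSpace (𝓡 n) x} {x : M}
    (hs : MDifferentiableAt (𝓡 n) (cotModel n)
      (fun x => (TotalSpace.mk x (s x) : CotangentBundle n M)) x)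
    (hY : MDifferentiableAt (𝓡 n) (𝓡 n).tangent
      (fun y => (TotalSpace.mk y (Y y) : TangentBundle (𝓡 n) M)) x) (u : TangentSpace (𝓡 n) x) :
    dualCov D s Y x u =
      chartDeriv x (covRead x s) u (Y x) - (s x (christoffel D x (Y x) u) : ℝ) := by
  have hc : MDifferentiableAt (𝓡 n) 𝓘(ℝ, Dual n) (covRead x s) x :=
    ((mdifferentiableAt_totalSpace (𝓡 n) _).1 hs).2
  have hy := mdifferentiableAt_vecRead hY
  have h1 := hasFDerivAt_comp_extChartAt_symm (hc.clm_apply hy)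
  have h2 := h1.unique ((hasFDerivAt_comp_extChartAt_symm hc).clm_apply
    (hasFDerivAt_comp_extChartAt_symm hy))
  have h3 : (fun m => covRead x s m (vecRead x Y m)) =ᶠ[nhds x] fun m => (s m (Y m) : ℝ) := by
    filter_upwards [(chartAt (EuclideanSpace ℝ (Fin n)) x).open_source.mem_nhds
      (mem_chart_source _ x)] with m hm
    exact covRead_vecRead x s Y hm
  have h4 : mvfderiv (𝓡 n) (fun y => (s y (Y y) : ℝ)) x u =
      chartDeriv x (fun m => covRead x s m (vecRead x Y m)) u := by
    rw [chartDeriv_congr h3]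
    rfl
  have h5 := congrArg (fun A : EuclideanSpace ℝ (Fin n) →L[ℝ] ℝ => A u) h2
  simp only [extChartAt_to_inv, vecRead_self, covRead_self] at h5
  have h6 : chartDeriv x (fun m => covRead x s m (vecRead x Y m)) u =
    s x (vecDeriv x Y u) + chartDeriv x (covRead x s) u (Y x) := h5
  rw [dualCov, h4, h6, connection_apply D hY, map_add]
  exact add_sub_add_left_eq_sub _ _ _

/-- The differential of a section at `x` in direction `u` is `(u, ∂_u s)`, and `∇_u s = 0` says `∂_u
s = ξ(Γ(·, u))`. Global test fields `Y` with any prescribed value at `x` give one direction; a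
global section with prescribed value and derivative at `x` gives the other. -/
theorem mem_horizontalSpace_iff [T2Space M] (D : Connection n M) (ξ : CotangentBundle n M)
    (Z : EuclideanSpace ℝ (Fin n) × Dual n) :
    (Z : TangentSpace (cotModel n) ξ) ∈ horizontalSpace D ξ ↔
      ∀ v : EuclideanSpace ℝ (Fin n), Z.2 v = ξ.snd (christoffel D ξ.proj v Z.1) := by
  obtain ⟨x, p⟩ := ξ
  constructor
  · rintro ⟨s, u, hs, hh, ht⟩ v
    obtain rfl : s x = p := by
      simpa [tangentMap] using congrArg TotalSpace.proj ht
    have hs' := (hs x).mdifferentiableAt (by simp)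
    have hZ : mfderiv (𝓡 n) (cotModel n)
        (fun x => (TotalSpace.mk x (s x) : CotangentBundle n M)) x u = Z :=
      TotalSpace.mk_inj.1 ht
    rw [mfderiv_section hs' u] at hZ
    obtain ⟨Y, hY, hYv⟩ := exists_contMDiff_section (I := 𝓡 n) (F := EuclideanSpace ℝ (Fin n))
      (V := (TangentSpace (𝓡 n) : M → Type)) (x := x) Filter.univ_mem
      (contMDiffOn_const (c := v))
    have hYx : Y x = v := by
      refine (vecRead_self x Y).symm.trans (Eq.trans ?_ hYv.self_of_nhds)
      rw [vecRead, Trivialization.continuousLinearMapAt_apply,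
        Trivialization.coe_linearMapAt_of_mem _ (mem_baseSet_trivializationAt' x)]
    have h := hh Y hY
    rw [dualCov_eq D hs' ((hY x).mdifferentiableAt (by simp)), sub_eq_zero, hYx] at h
    rw [← hZ]
    exact h
  · intro h
    let Γ : EuclideanSpace ℝ (Fin n) →L[ℝ] EuclideanSpace ℝ (Fin n) →L[ℝ]
      EuclideanSpace ℝ (Fin n) := christoffel D x
    let p' : Dual n := p
    -- `L u = p(Γ(·, u))` is the derivative that parallelism at `x` imposes; the section is the
    -- affine covector field `g` with this derivative, globalized.
    let L : EuclideanSpace ℝ (Fin n) →L[ℝ] Dual n :=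
      ((ContinuousLinearMap.compL ℝ (EuclideanSpace ℝ (Fin n)) (EuclideanSpace ℝ (Fin n)) ℝ
        p').comp Γ).flip
    let g : EuclideanSpace ℝ (Fin n) → Dual n := fun y => p' + L (y - extChartAt (𝓡 n) x x)
    have hg : HasFDerivAt g L (extChartAt (𝓡 n) x x) :=
      (L.hasFDerivAt.comp _ ((hasFDerivAt_id _).sub_const _)).const_add _
    have hg' : ContDiff ℝ ∞ g := contDiff_const.add (L.contDiff.comp (contDiff_id.sub contDiff_const))
    have hf : ContMDiffOn (𝓡 n) 𝓘(ℝ, Dual n) ∞ (fun m => g (extChartAt (𝓡 n) x m))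
        (chartAt (EuclideanSpace ℝ (Fin n)) x).source :=
      hg'.contMDiff.comp_contMDiffOn contMDiffOn_extChartAt
    obtain ⟨s, hs, hsf⟩ := exists_contMDiff_section (I := 𝓡 n) (F := Dual n)
      (V := (CotangentSpace n : M → Type)) (chart_source_mem_nhds _ x) hf
    have hs' := (hs x).mdifferentiableAt (by simp)
    have hf' := hasFDerivAt_comp_extChartAt_symm
      ((hf.contMDiffAt (chart_source_mem_nhds _ x)).mdifferentiableAt (by simp))
    have hL : chartDeriv x (covRead x s) = L := by
      refine (chartDeriv_congr hsf).trans ?_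
      refine hf'.unique (hg.congr_of_eventuallyEq ?_)
      filter_upwards [extChartAt_target_mem_nhds x] with y hy
      rw [(extChartAt (𝓡 n) x).right_inv hy]
    obtain rfl : s x = p := by
      rw [← covRead_self x s]
      have hp : g (extChartAt (𝓡 n) x x) = p' := by simp [g]
      exact hsf.self_of_nhds.trans hp
    refine ⟨s, Z.1, hs, fun Y hY => ?_, ?_⟩
    · refine (dualCov_eq D hs' ((hY x).mdifferentiableAt (by simp)) Z.1).trans (sub_eq_zero.2 ?_)
      rw [hL]
      rfl
    · refine TotalSpace.mk_inj.2 ((mfderiv_section hs' Z.1).trans (Prod.ext rfl ?_))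
      rw [hL]
      exact ContinuousLinearMap.ext fun v => (h v).symm

end Horizontal

/-! ### Explicit formulas characterizing the two lifts. -/

section LiftFormulas

/-- The endomorphism `(v, p) ↦ (A v, p ∘ A + B v)` of `E × E*`. -/
def blockEnd {E : Type*} [NormedAddCommGroup E] [NormedSpace ℝ E] (A : E →L[ℝ] E)
    (B : E →L[ℝ] E →L[ℝ] ℝ) : E × (E →L[ℝ] ℝ) →L[ℝ] E × (E →L[ℝ] ℝ) :=
  (A.comp (ContinuousLinearMap.fst ℝ E (E →L[ℝ] ℝ))).prod
    (((ContinuousLinearMap.compL ℝ E E ℝ).flip A).comp (ContinuousLinearMap.snd ℝ E (E →L[ℝ] ℝ)) +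
      B.comp (ContinuousLinearMap.fst ℝ E (E →L[ℝ] ℝ)))

variable {n : ℕ} {M : Type*} [TopologicalSpace M] [ChartedSpace (EuclideanSpace ℝ (Fin n)) M]
  [IsManifold (𝓡 n) ∞ M]

theorem endRead_id_eventuallyEq (x : M) :
    endRead x (fun y => ContinuousLinearMap.id ℝ (TangentSpace (𝓡 n) y)) =ᶠ[nhds x]
      fun _ => ContinuousLinearMap.id ℝ (EuclideanSpace ℝ (Fin n)) := by
  filter_upwards [(trivializationAt (EuclideanSpace ℝ (Fin n)) (TangentSpace (𝓡 n))
    x).open_baseSet.mem_nhds (mem_baseSet_trivializationAt' x)] with m hm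
  ext1 v
  exact Trivialization.continuousLinearMapAt_symmL _ hm v

/-- The Liouville form is `θ(Id)`, and the identity field has a locally constant reading, so the
derivative term vanishes. -/
theorem omegaSt_apply (ξ : CotangentBundle n M) (v w : EuclideanSpace ℝ (Fin n) × Dual n) :
    omegaSt ξ v w = v.2 w.1 - w.2 v.1 := by
  have hid : MDifferentiableAt (𝓡 n)
      ((𝓡 n).prod 𝓘(ℝ, EuclideanSpace ℝ (Fin n) →L[ℝ] EuclideanSpace ℝ (Fin n)))
      (fun x => TotalSpace.mk' (EuclideanSpace ℝ (Fin n) →L[ℝ] EuclideanSpace ℝ (Fin n))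
        (E := fun y : M => TangentSpace (𝓡 n) y →L[ℝ] TangentSpace (𝓡 n) y) x
        (ContinuousLinearMap.id ℝ (TangentSpace (𝓡 n) x))) ξ.proj :=
    (mdifferentiableAt_hom_bundle _).2 ⟨mdifferentiableAt_id,
      mdifferentiableAt_const.congr_of_eventuallyEq (endRead_id_eventuallyEq ξ.proj)⟩
  have hd : chartDeriv (n := n) ξ.proj
      (endRead ξ.proj (fun y => ContinuousLinearMap.id ℝ (TangentSpace (𝓡 n) y))) = 0 := by
    rw [chartDeriv_congr (endRead_id_eventuallyEq ξ.proj)]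
    exact mvfderiv_const _
  have h := extDerivOneForm_thetaForm ξ hid v w
  have hd' (a b : EuclideanSpace ℝ (Fin n)) :
      endDeriv ξ.proj (fun y => ContinuousLinearMap.id ℝ (TangentSpace (𝓡 n) y)) a b = 0 :=
    congrArg (fun A : EuclideanSpace ℝ (Fin n) →L[ℝ] EuclideanSpace ℝ (Fin n) →L[ℝ]
      EuclideanSpace ℝ (Fin n) => A a b) hd
  rw [hd', hd', sub_zero, map_zero, add_zero] at h
  exact h

/-- The complete lift in the preferred chart. -/
def completeFormula (J : AlmostComplexStructure n M) (ξ : CotangentBundle n M) :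
    EuclideanSpace ℝ (Fin n) × Dual n →L[ℝ] EuclideanSpace ℝ (Fin n) × Dual n :=
  let p : Dual n := ξ.snd
  let D : EuclideanSpace ℝ (Fin n) →L[ℝ] EuclideanSpace ℝ (Fin n) →L[ℝ]
    EuclideanSpace ℝ (Fin n) := endDeriv ξ.proj J
  blockEnd (J ξ.proj) ((ContinuousLinearMap.compL ℝ (EuclideanSpace ℝ (Fin n))
    (EuclideanSpace ℝ (Fin n)) ℝ p).comp (D - D.flip))

/-- The generalized horizontal lift in the preferred chart. -/
def generalizedFormula (J : AlmostComplexStructure n M) (nabla : Connection n M)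
    (ξ : CotangentBundle n M) :
    EuclideanSpace ℝ (Fin n) × Dual n →L[ℝ] EuclideanSpace ℝ (Fin n) × Dual n :=
  let p : Dual n := ξ.snd
  let A : EuclideanSpace ℝ (Fin n) →L[ℝ] EuclideanSpace ℝ (Fin n) := J ξ.proj
  let Γ : EuclideanSpace ℝ (Fin n) →L[ℝ] EuclideanSpace ℝ (Fin n) →L[ℝ]
    EuclideanSpace ℝ (Fin n) := christoffel nabla ξ.proj
  let P : EuclideanSpace ℝ (Fin n) →L[ℝ] Dual n :=
    (ContinuousLinearMap.compL ℝ (EuclideanSpace ℝ (Fin n)) (EuclideanSpace ℝ (Fin n)) ℝ p).comp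
      Γ.flip
  blockEnd A (P.comp A - ((ContinuousLinearMap.compL ℝ (EuclideanSpace ℝ (Fin n))
    (EuclideanSpace ℝ (Fin n)) ℝ).flip A).comp P)

theorem isCompleteLift_iff (J : AlmostComplexStructure n M) (K : EndField n M) :
    IsCompleteLift J K ↔ K = completeFormula J := by
  -- The formula satisfies `d(θ(J)) = ω(K ·, ·)`; the converse is then nondegeneracy of `ω`, tested
  -- on vectors `(0, q)` and `(e, 0)`.
  have hf (ξ : CotangentBundle n M) (v w : EuclideanSpace ℝ (Fin n) × Dual n) :
      extDerivOneForm (cotModel n) (thetaForm (n := n) (M := M) J) ξ v w =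
        (completeFormula J ξ v).2 w.1 - w.2 (completeFormula J ξ v).1 := by
    rw [extDerivOneForm_thetaForm ξ ((J.smooth ξ.proj).mdifferentiableAt (by simp)) v w]
    exact sub_add_eq_add_sub _ _ _
  constructor
  · intro h
    funext ξ
    refine ContinuousLinearMap.ext fun v => ?_
    let Kv : EuclideanSpace ℝ (Fin n) × Dual n := K ξ v
    have key (w : EuclideanSpace ℝ (Fin n) × Dual n) : (completeFormula J ξ v).2 w.1 -
        w.2 (completeFormula J ξ v).1 = Kv.2 w.1 - w.2 Kv.1 :=
      (hf ξ v w).symm.trans ((h ξ v w).trans (omegaSt_apply ξ Kv w))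
    have h1 : Kv.1 = (completeFormula J ξ v).1 := by
      refine (SeparatingDual.eq_iff_forall_dual_eq (R := ℝ)).2 fun q => ?_
      simpa using (key (0, q)).symm
    have h2 : Kv.2 = (completeFormula J ξ v).2 := by
      refine ContinuousLinearMap.ext fun e => ?_
      simpa using (key (e, 0)).symm
    exact Prod.ext h1 h2
  · rintro rfl ξ v w
    exact (hf ξ v w).trans (omegaSt_apply ξ _ w).symm

theorem isGeneralizedHorizontalLift_iff [T2Space M] (J : AlmostComplexStructure n M)
    (nabla : Connection n M) (K : EndField n M) :
    IsGeneralizedHorizontalLift J nabla K ↔ K = generalizedFormula J nabla := by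
  constructor
  · intro h
    funext ξ
    refine ContinuousLinearMap.ext fun v => ?_
    let p : Dual n := ξ.snd
    let A : EuclideanSpace ℝ (Fin n) →L[ℝ] EuclideanSpace ℝ (Fin n) := J ξ.proj
    let Γ : EuclideanSpace ℝ (Fin n) →L[ℝ] EuclideanSpace ℝ (Fin n) →L[ℝ]
      EuclideanSpace ℝ (Fin n) := christoffel nabla ξ.proj
    let v' : EuclideanSpace ℝ (Fin n) × Dual n := v
    -- The horizontal lift of `u`. Every `v` splits as `hor v.1` plus the vertical vector of `α =
    -- v.2 - (hor v.1).2`, and the horizontal vector over `J v.1` is `hor (J v.1)`.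
    let hor (u : EuclideanSpace ℝ (Fin n)) : EuclideanSpace ℝ (Fin n) × Dual n :=
      (u, p.comp (Γ.flip u))
    have hhor (u : EuclideanSpace ℝ (Fin n)) :
        (hor u : TangentSpace (cotModel n) ξ) ∈ horizontalSpace nabla ξ :=
      (mem_horizontalSpace_iff nabla ξ (hor u)).2 fun _ => rfl
    let K' : EuclideanSpace ℝ (Fin n) × Dual n →L[ℝ] EuclideanSpace ℝ (Fin n) × Dual n := K ξ
    let α : Dual n := v'.2 - (hor v'.1).2
    let w : EuclideanSpace ℝ (Fin n) × Dual n := vert ξ α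
    let w' : EuclideanSpace ℝ (Fin n) × Dual n := vert ξ (α.comp A)
    have hw : w = (0, α) := vert_apply ξ α
    have hw' : w' = (0, α.comp A) := vert_apply ξ (α.comp A)
    have h1 : K' (hor v'.1 + w) = hor (A v'.1) + w' := h ξ _ (hhor v'.1) _ (hhor (A v'.1))
      ((dπ_apply ξ _).trans (congrArg (J ξ.proj) (dπ_apply ξ (hor v'.1)).symm)) α
    rw [hw, hw'] at h1
    have h2 : hor v'.1 + (0, α) = v' := by
      ext1 <;> simp [hor, α]
    have h3 : hor (A v'.1) + (0, α.comp A) = generalizedFormula J nabla ξ v' := by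
      ext1
      · exact add_zero _
      · refine ContinuousLinearMap.ext fun w => ?_
        have key : ∀ a b c : ℝ, a + (b - c) = b + (a - c) := fun a b c => by ring
        exact key _ _ _
    exact (congrArg K' h2.symm).trans (h1.trans h3)
  · rintro rfl ξ h hh h' hh' hJ α
    let p : Dual n := ξ.snd
    let A : EuclideanSpace ℝ (Fin n) →L[ℝ] EuclideanSpace ℝ (Fin n) := J ξ.proj
    let Γ : EuclideanSpace ℝ (Fin n) →L[ℝ] EuclideanSpace ℝ (Fin n) →L[ℝ]
      EuclideanSpace ℝ (Fin n) := christoffel nabla ξ.proj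
    let a : Dual n := α
    let k : EuclideanSpace ℝ (Fin n) × Dual n := h
    let k' : EuclideanSpace ℝ (Fin n) × Dual n := h'
    have hk : ∀ w, k.2 w = p (Γ w k.1) := (mem_horizontalSpace_iff nabla ξ k).1 hh
    have hk' : ∀ w, k'.2 w = p (Γ w k'.1) := (mem_horizontalSpace_iff nabla ξ k').1 hh'
    have hA : k'.1 = A k.1 :=
      (dπ_apply ξ k').symm.trans (hJ.trans (congrArg (J ξ.proj) (dπ_apply ξ k)))
    have key : generalizedFormula J nabla ξ (k + (0, a)) = k' + (0, a.comp A) := by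
      refine Prod.ext ?_ (ContinuousLinearMap.ext fun w => ?_)
      · change A (k.1 + 0) = k'.1 + 0
        rw [add_zero, add_zero, hA]
      · change (k.2 (A w) + a (A w)) + (p (Γ w (A (k.1 + 0))) - p (Γ (A w) (k.1 + 0))) =
          k'.2 w + a (A w)
        rw [hk, hk', hA, add_zero]
        ring
    have e1 := vert_apply ξ a
    have e2 := vert_apply ξ (a.comp A)
    exact (congrArg (fun z => generalizedFormula J nabla ξ (k + z)) e1).trans
      (key.trans (congrArg (fun z => k' + z) e2.symm))

end LiftFormulas

/-! ### Comparison of the two lifts. -/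

theorem completeFormula_add_gammaContraction {n : ℕ} {M : Type*} [TopologicalSpace M]
    [ChartedSpace (EuclideanSpace ℝ (Fin n)) M] [IsManifold (𝓡 n) ∞ M]
    (J : AlmostComplexStructure n M) (nabla : Connection n M) (ξ : CotangentBundle n M)
    (v γ : EuclideanSpace ℝ (Fin n) × Dual n)
    (hγv : γ = gammaContraction (bracketNablaJ J (symmetrized nabla)) ξ v) :
    completeFormula J ξ v + γ = generalizedFormula J (symmetrized nabla) ξ v := by
  let p : Dual n := ξ.snd
  let A : EuclideanSpace ℝ (Fin n) →L[ℝ] EuclideanSpace ℝ (Fin n) := J ξ.proj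
  let Γ : EuclideanSpace ℝ (Fin n) →L[ℝ] EuclideanSpace ℝ (Fin n) →L[ℝ]
    EuclideanSpace ℝ (Fin n) := christoffel (symmetrized nabla) ξ.proj
  let D : EuclideanSpace ℝ (Fin n) →L[ℝ] EuclideanSpace ℝ (Fin n) →L[ℝ]
    EuclideanSpace ℝ (Fin n) := endDeriv ξ.proj J
  let B : EuclideanSpace ℝ (Fin n) →L[ℝ] EuclideanSpace ℝ (Fin n) →L[ℝ]
    EuclideanSpace ℝ (Fin n) := bracketNablaJ J (symmetrized nabla) ξ.proj
  have hΓ (a b : EuclideanSpace ℝ (Fin n)) : Γ a b = Γ b a :=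
    christoffel_symmetrized_comm nabla ξ.proj a b
  have hB (a b : EuclideanSpace ℝ (Fin n)) :
      B a b = -(D a b + Γ (A b) a - A (Γ b a)) + (D b a + Γ (A a) b - A (Γ a b)) :=
    congrArg₂ (fun c d : EuclideanSpace ℝ (Fin n) => -c + d)
      (nablaJ_eq J (symmetrized nabla) ξ.proj a b) (nablaJ_eq J (symmetrized nabla) ξ.proj b a)
  have hγ : gammaContraction (bracketNablaJ J (symmetrized nabla)) ξ v =
      ((0, p.comp (B v.1)) : EuclideanSpace ℝ (Fin n) × Dual n) := by
    have h := vert_apply ξ (p.comp (B (dπ ξ v)))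
    rw [dπ_apply] at h
    refine Eq.trans ?_ h
    rw [← dπ_apply ξ v]
    rfl
  rw [hγv.trans hγ]
  refine Prod.ext (add_zero _) (ContinuousLinearMap.ext fun w => ?_)
  change v.2 (A w) + p (D v.1 w - D w v.1) + p (B v.1 w) =
    v.2 (A w) + (p (Γ w (A v.1)) - p (Γ (A w) v.1))
  -- Symmetry puts `Γ w v.1` and `Γ w (A v.1)` in the order used by `hB`; the `∂J` and `J Γ` terms
  -- then cancel after applying `p`.
  rw [hB, hΓ w v.1, hΓ w (A v.1)]
  simp only [map_add, map_sub, map_neg]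
  ring

end CotangentLift

end

theorem mainTheorem10 {n : ℕ} {M : Type*} [TopologicalSpace M] [T2Space M]
    [ChartedSpace (EuclideanSpace ℝ (Fin n)) M] [IsManifold (𝓡 n) ∞ M]
    (J : CotangentLift.AlmostComplexStructure n M) (nabla : CotangentLift.Connection n M)
    [CovariantDerivative.ContMDiffCovariantDerivative nabla ∞] :
    (∃! K, CotangentLift.IsCompleteLift J K) ∧
    (∃! K, CotangentLift.IsGeneralizedHorizontalLift J (CotangentLift.symmetrized nabla) K) ∧
    CotangentLift.horizontalLift J nabla =
      CotangentLift.generalizedHorizontalLift J (CotangentLift.symmetrized nabla) := by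
  have hc : CotangentLift.IsCompleteLift J (CotangentLift.completeFormula J) :=
    (CotangentLift.isCompleteLift_iff J _).2 rfl
  have hg : CotangentLift.IsGeneralizedHorizontalLift J (CotangentLift.symmetrized nabla)
      (CotangentLift.generalizedFormula J (CotangentLift.symmetrized nabla)) :=
    (CotangentLift.isGeneralizedHorizontalLift_iff J _ _).2 rfl
  refine ⟨⟨_, hc, fun K hK => (CotangentLift.isCompleteLift_iff J K).1 hK⟩,
    ⟨_, hg, fun K hK => (CotangentLift.isGeneralizedHorizontalLift_iff J _ K).1 hK⟩, ?_⟩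
  -- Existence makes the `epsilon` choice satisfy the defining property, and uniqueness identifies
  -- it with the formula.
  have hc' : CotangentLift.completeLift J = CotangentLift.completeFormula J :=
    (CotangentLift.isCompleteLift_iff J _).1 (Classical.epsilon_spec ⟨_, hc⟩)
  have hg' : CotangentLift.generalizedHorizontalLift J (CotangentLift.symmetrized nabla) =
      CotangentLift.generalizedFormula J (CotangentLift.symmetrized nabla) :=
    (CotangentLift.isGeneralizedHorizontalLift_iff J _ _).1 (Classical.epsilon_spec ⟨_, hg⟩)
  rw [hg']
  funext ξ
  rw [CotangentLift.horizontalLift, hc']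
  exact ContinuousLinearMap.ext fun v =>
    CotangentLift.completeFormula_add_gammaContraction J nabla ξ v _ rfl
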